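/- Let $\hat\rho,\hat\sigma$ be density matrices (positive semidefinite, trace one) on a finite-dimensional complex Hilbert space with the same eigenvalues, counted with multiplicity, and let $\|\cdot\|$ be the operator norm. A charging Hamiltonian on $[0,T]$ is a measurable family $(\hat V_t)_{t\in[0,T]}$ of Hermitian matrices with $\|\hat V_t\|=1$ for all $t$; it generates the unitary $U=\mathrm{Texp}\left(-i\int_0^T\hat V_t\,dt\right)=\Phi_T$, where $\Phi$ is the continuous solution of $\Phi_t=1-i\int_0^t\hat V_s\Phi_s\,ds$ on $[0,T]$, and it evolves $\hat\rho$ into $\hat\sigma$ in time $T\ge 0$ if $U\hat\rho U^\dagger=\hat\sigma$. The charging distance $D(\hat\rho,\hat\sigma)$ is the infimum of the times $T\ge0$ in which some charging Hamiltonian evolves $\hat\rho$ into $\hat\sigma$. For a unitary $U$ let $\ln U$ be its principal logarithm (principal branch, imaginary part in $(-\pi,\pi]$, applied to the eigenvalues). Then the infimum is attained, and it is attained by some time-independent charging Hamiltonian. Moreover \[ D(\hat\rho,\hat\sigma)=\min_{U:\,U\hat\rho U^\dagger=\hat\sigma}\|i\ln U\|, \] where the minimum runs over all unitaries $U$ with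 $U\hat\rho U^\dagger=\hat\sigma$ and is attained. Every unitary $U_{\mathrm{opt}}$ attaining this minimum is generated in time $D(\hat\rho,\hat\sigma)$ by a time-independent charging Hamiltonian, which therefore evolves $\hat\rho$ into $\hat\sigma$ in the shortest possible time. If $\hat\rho\ne\hat\sigma$, then $D(\hat\rho,\hat\sigma)>0$ and one may take this Hamiltonian to be $\hat V_{\mathrm{opt}}=i\ln(U_{\mathrm{opt}})/D(\hat\rho,\hat\sigma)$. -/

import Mathlib

open scoped ComplexOrder Matrix Matrix.Norms.L2Operator

namespace QuantumCharging

variable {n : Type*} [Fintype n] [DecidableEq n]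

/-- Density matrices: positive semidefinite with unit trace. -/
def IsDensityMatrix (ρ : Matrix n n ℂ) : Prop :=
  ρ.PosSemidef ∧ ρ.trace = 1

/-- The eigenvalues of `ρ` and `σ` agree, counted with multiplicity. -/
def SameSpectrum (ρ σ : Matrix n n ℂ) : Prop :=
  ρ.charpoly.roots = σ.charpoly.roots

/-- A (possibly time-dependent) charging Hamiltonian on `[0, T]`: measurable in time, Hermitian,
and of operator norm one at every time. -/
structure IsChargingHamiltonian (T : ℝ) (V : ℝ → Matrix n n ℂ) : Prop where
  measurable : MeasureTheory.AEStronglyMeasurable V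
    (MeasureTheory.volume.restrict (Set.Icc 0 T))
  hermitian : ∀ t ∈ Set.Icc 0 T, (V t).IsHermitian
  norm_eq_one : ∀ t ∈ Set.Icc 0 T, ‖V t‖ = 1

/-- `U` is the time-ordered exponential `Texp (-i ∫₀ᵀ V_t dt)`: the value at time `T` of the
continuous solution of `Φ t = 1 - i ∫₀ᵗ V_s Φ_s ds`, the integrated form of
`Φ' = -i V Φ`, `Φ 0 = 1`. -/
def IsTimeOrderedExp (V : ℝ → Matrix n n ℂ) (T : ℝ) (U : Matrix n n ℂ) : Prop :=
  ∃ Φ : ℝ → Matrix n n ℂ,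
    ContinuousOn Φ (Set.Icc 0 T) ∧
    (∀ t ∈ Set.Icc 0 T, Φ t = 1 - Complex.I • ∫ s in (0 : ℝ)..t, V s * Φ s) ∧
    Φ T = U

/-- The charging Hamiltonian `V` evolves `ρ` into `σ` in time `T`. -/
def Charges (ρ σ : Matrix n n ℂ) (V : ℝ → Matrix n n ℂ) (T : ℝ) : Prop :=
  0 ≤ T ∧ IsChargingHamiltonian T V ∧
    ∃ U : Matrix n n ℂ, IsTimeOrderedExp V T U ∧ U * ρ * Uᴴ = σ

/-- All times in which some charging Hamiltonian evolves `ρ` into `σ`. -/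
def chargingTimes (ρ σ : Matrix n n ℂ) : Set ℝ :=
  {T | ∃ V : ℝ → Matrix n n ℂ, Charges ρ σ V T}

/-- The quantum charging distance. -/
noncomputable def chargingDistance (ρ σ : Matrix n n ℂ) : ℝ :=
  sInf (chargingTimes ρ σ)

/-- The unitaries that transform `ρ` into `σ`. -/
def connectingUnitaries (ρ σ : Matrix n n ℂ) : Set (Matrix n n ℂ) :=
  {U | U ∈ Matrix.unitaryGroup n ℂ ∧ U * ρ * Uᴴ = σ}

/-- The principal logarithm of a normal matrix: the principal branch of the complex logarithm
(imaginary part in `(-π, π]`) applied to its eigenvalues. The spectrum is finite, so every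
function is continuous on it and the functional calculus always applies. -/
noncomputable def matrixLog (U : Matrix n n ℂ) : Matrix n n ℂ :=
  cfc Complex.log U

/-- `U` attains the minimum of `‖i ln U‖` over the unitaries that transform `ρ` into `σ`. -/
def IsOptimalUnitary (ρ σ U : Matrix n n ℂ) : Prop :=
  U ∈ connectingUnitaries ρ σ ∧
    ∀ W ∈ connectingUnitaries ρ σ, ‖Complex.I • matrixLog U‖ ≤ ‖Complex.I • matrixLog W‖

end QuantumCharging

open scoped ComplexOrder Matrix Matrix.Norms.L2Operator

namespace QuantumCharging

open Set Filter Topology MeasureTheory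

/-! ### Arc length and angle on the unit sphere -/

section Sphere

variable {E : Type*} [NormedAddCommGroup E] [InnerProductSpace ℝ E]

/-! Lower bound: a Hamiltonian of norm one moves each unit vector along the sphere at speed at most
one, so in time `T` it turns the vector by an angle at most `T` (`angle_le_of_lipschitz_on_sphere`).
For `T ≤ π` this bounds chords, giving `‖U - 1‖ ≤ 2 sin (T / 2)`. Since `‖i ln U‖ = 2 arcsin (‖U -
1‖ / 2)` (`norm_smul_matrixLog`), it follows that `‖i ln U‖ ≤ T`; for `T ≥ π` this is automatic.

Upper bound: the constant Hamiltonian `i ln U / ‖i ln U‖` generates `U` in time exactly `‖i ln U‖`.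
Charging times are thus minimised exactly where `‖i ln U‖` is, and that minimum exists because the
connecting unitaries form a nonempty compact set on which the arcsine formula is continuous. -/

lemma norm_sub_eq_two_mul_sin_half_angle {x y : E} (hx : ‖x‖ = 1) (hy : ‖y‖ = 1) :
    ‖x - y‖ = 2 * Real.sin (InnerProductGeometry.angle x y / 2) := by
  set θ := InnerProductGeometry.angle x y with hθ
  have h0 : 0 ≤ θ := InnerProductGeometry.angle_nonneg x y
  have hpi : θ ≤ Real.pi := InnerProductGeometry.angle_le_pi x y
  have hs : 0 ≤ Real.sin (θ / 2) := Real.sin_nonneg_of_nonneg_of_le_pi (by linarith) (by linarith)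
  have hc : Real.cos θ = 1 - 2 * Real.sin (θ / 2) ^ 2 := by
    rw [← Real.cos_sq_add_sin_sq (θ / 2), show θ = 2 * (θ / 2) by ring, Real.cos_two_mul,
      Real.cos_sq' (2 * (θ / 2) / 2)]
    ring_nf
    rw [Real.cos_sq' (θ * (1 / 2))]
    ring
  have h := norm_sub_sq_real x y
  rw [← InnerProductGeometry.cos_angle_mul_norm_mul_norm, ← hθ, hx, hy, hc] at h
  refine (sq_eq_sq₀ (norm_nonneg _) (by positivity)).1 ?_
  rw [h]; ring

lemma angle_eq_two_mul_arcsin {x y : E} (hx : ‖x‖ = 1) (hy : ‖y‖ = 1) :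
    InnerProductGeometry.angle x y = 2 * Real.arcsin (‖x - y‖ / 2) := by
  have h0 := InnerProductGeometry.angle_nonneg x y
  have hpi := InnerProductGeometry.angle_le_pi x y
  rw [norm_sub_eq_two_mul_sin_half_angle hx hy, mul_div_cancel_left₀ _ two_ne_zero,
    Real.arcsin_sin (by linarith [Real.pi_pos]) (by linarith)]
  ring

/-- This is the derivative `T` of `u ↦ 2 arcsin (T u / 2)` at zero, sampled at `u = 1 / N`. It turns
a sum of `N` chord estimates into an arc length. -/
lemma tendsto_nat_mul_two_mul_arcsin (T : ℝ) :
    Tendsto (fun N : ℕ => (N : ℝ) * (2 * Real.arcsin (T / N / 2))) atTop (𝓝 T) := by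
  have hd : HasDerivAt (fun u : ℝ => 2 * Real.arcsin (T * u / 2)) T 0 := by
    have h1 : HasDerivAt (fun u : ℝ => T * u / 2) (T / 2) 0 := by
      simpa using ((hasDerivAt_id (0 : ℝ)).const_mul T).div_const 2
    have h2 : HasDerivAt Real.arcsin (1 / √(1 - (T * 0 / 2) ^ 2)) (T * 0 / 2) :=
      Real.hasDerivAt_arcsin (by norm_num) (by norm_num)
    have h3 := (h2.comp 0 h1).const_mul 2
    have h4 : 2 * (1 / √(1 - (T * 0 / 2) ^ 2) * (T / 2)) = T := by
      rw [mul_zero, zero_div, zero_pow two_ne_zero, sub_zero, Real.sqrt_one]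
      ring
    rw [h4] at h3
    exact h3
  rw [hasDerivAt_iff_tendsto_slope_zero] at hd
  have hN : Tendsto (fun N : ℕ => ((N : ℝ))⁻¹) atTop (𝓝[≠] 0) := by
    refine tendsto_nhdsWithin_iff.2 ⟨tendsto_inv_atTop_nhds_zero_nat, ?_⟩
    filter_upwards [eventually_gt_atTop 0] with N hN
    simpa using hN.ne'
  refine (hd.comp hN).congr fun N => ?_
  simp [div_eq_mul_inv]

/-- A curve of speed at most one on the unit sphere sweeps an angle of at most its duration. -/
lemma angle_le_of_lipschitz_on_sphere {γ : ℝ → E} {T : ℝ} (hT : 0 ≤ T)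
    (hnorm : ∀ t ∈ Icc 0 T, ‖γ t‖ = 1)
    (hlip : ∀ s ∈ Icc 0 T, ∀ t ∈ Icc 0 T, s ≤ t → ‖γ s - γ t‖ ≤ t - s) :
    InnerProductGeometry.angle (γ 0) (γ T) ≤ T := by
  -- Cut `[0, T]` into `N` equal steps: each chord has length at most `T / N`, and the angles add up
  -- by the triangle inequality.
  have key : ∀ N : ℕ, 0 < N → ∀ k : ℕ, k ≤ N →
      InnerProductGeometry.angle (γ 0) (γ (k * (T / N))) ≤
        k * (2 * Real.arcsin (T / N / 2)) := by
    intro N hN k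
    have hN' : (0 : ℝ) < N := by exact_mod_cast hN
    have hmem : ∀ j : ℕ, j ≤ N → (j : ℝ) * (T / N) ∈ Icc 0 T := by
      intro j hj
      have hj' : (j : ℝ) ≤ N := by exact_mod_cast hj
      refine ⟨by positivity, ?_⟩
      calc (j : ℝ) * (T / N) ≤ N * (T / N) := by gcongr
        _ = T := by field_simp
    induction k with
    | zero =>
      intro _
      have h0 : ‖γ 0‖ = 1 := hnorm 0 ⟨le_rfl, hT⟩
      have : γ 0 ≠ 0 := by
        intro h
        simp [h] at h0
      simp [InnerProductGeometry.angle_self this]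
    | succ k ih =>
      intro hk
      have hk0 := hmem k (by omega)
      have hk1 := hmem (k + 1) hk
      have hstep : InnerProductGeometry.angle (γ (k * (T / N))) (γ ((k + 1 : ℕ) * (T / N))) ≤
          2 * Real.arcsin (T / N / 2) := by
        rw [angle_eq_two_mul_arcsin (hnorm _ hk0) (hnorm _ hk1)]
        have hs : (0 : ℝ) ≤ T / N := by positivity
        have := hlip _ hk0 _ hk1 (by push_cast; linarith)
        have hle := Real.monotone_arcsin (show ‖γ (k * (T / N)) - γ ((k + 1 : ℕ) * (T / N))‖ / 2 ≤
          T / N / 2 by push_cast at this ⊢; linarith)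
        linarith
      have htri := InnerProductGeometry.angle_le_angle_add_angle
        (γ 0) (γ (k * (T / N))) (γ ((k + 1 : ℕ) * (T / N)))
      have := ih (by omega)
      push_cast at *
      linarith
  refine ge_of_tendsto (tendsto_nat_mul_two_mul_arcsin T) ?_
  filter_upwards [eventually_gt_atTop 0] with N hN
  have := key N hN N le_rfl
  rwa [mul_div_cancel₀] at this
  exact_mod_cast hN.ne'

end Sphere

end QuantumCharging

namespace QuantumCharging

open Set Filter Topology MeasureTheory

/-! ### The principal logarithm of a unitary -/

section Log

variable {n : Type*} [Fintype n] [DecidableEq n]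

/-- On the unit circle `log z = i arg z`, and the chord from `1` to `z` is `2 sin (|arg z| / 2)`.
Only `|arg z|` enters, so the jump of the branch at `-1` is invisible. -/
lemma norm_log_eq_two_mul_arcsin {z : ℂ} (hz : ‖z‖ = 1) :
    ‖Complex.log z‖ = 2 * Real.arcsin (‖z - 1‖ / 2) := by
  have hlog : Complex.log z = Complex.I * (z.arg : ℂ) := by
    rw [Complex.log, hz, Real.log_one]
    simp [mul_comm]
  have hz' : z = Complex.exp (Complex.I * (z.arg : ℂ)) := by
    rw [← hlog, Complex.exp_log]
    rintro rfl
    simp at hz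
  have habs : |z.arg| ≤ Real.pi := Complex.abs_arg_le_pi z
  have hsin : ‖z - 1‖ = 2 * Real.sin (|z.arg| / 2) := by
    conv_lhs => rw [hz']
    rw [Complex.norm_exp_I_mul_ofReal_sub_one, norm_mul, Real.norm_eq_abs, Real.norm_eq_abs,
      abs_two]
    congr 1
    rcases abs_cases z.arg with ⟨h, h'⟩ | ⟨h, h'⟩ <;> rw [h] at habs ⊢
    · exact abs_of_nonneg (Real.sin_nonneg_of_nonneg_of_le_pi (by linarith) (by linarith))
    · rw [neg_div, Real.sin_neg]
      exact abs_of_nonpos (Real.sin_nonpos_of_nonpos_of_neg_pi_le (by linarith) (by linarith))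
  rw [hsin, mul_div_cancel_left₀ _ two_ne_zero,
    Real.arcsin_sin (by linarith [Real.pi_pos, abs_nonneg z.arg]) (by linarith), hlog]
  simp
  ring

lemma continuousOn_spectrum (f : ℂ → ℂ) (U : Matrix n n ℂ) : ContinuousOn f (spectrum ℂ U) :=
  (Matrix.finite_spectrum U).continuousOn f

lemma isStarNormal_of_mem_unitaryGroup {U : Matrix n n ℂ} (hU : U ∈ Matrix.unitaryGroup n ℂ) :
    IsStarNormal U :=
  (Unitary.coe_isStarNormal (⟨U, hU⟩ : unitary (Matrix n n ℂ)))

lemma norm_eq_one_of_mem_spectrum {U : Matrix n n ℂ} (hU : U ∈ Matrix.unitaryGroup n ℂ)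
    {z : ℂ} (hz : z ∈ spectrum ℂ U) : ‖z‖ = 1 := by
  have := Unitary.spectrum_subset_circle (⟨U, hU⟩ : unitary (Matrix n n ℂ)) hz
  simpa using this

/-- The norm of the principal logarithm of a unitary in terms of its distance to the identity;
in particular it depends continuously on the unitary. -/
lemma norm_smul_matrixLog [Nonempty n] {U : Matrix n n ℂ} (hU : U ∈ Matrix.unitaryGroup n ℂ) :
    ‖Complex.I • matrixLog U‖ = 2 * Real.arcsin (‖U - 1‖ / 2) := by
  have hN := isStarNormal_of_mem_unitaryGroup hU
  have hlog := IsGreatest.norm_cfc Complex.log U (continuousOn_spectrum _ _) hN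
  have hsub := IsGreatest.norm_cfc (fun z : ℂ => z - 1) U (continuousOn_spectrum _ _) hN
  have hcfc : cfc (fun z : ℂ => z - 1) U = U - 1 := by
    rw [cfc_sub _ _ U (continuousOn_spectrum _ _) (continuousOn_spectrum _ _), cfc_id' ℂ U,
      cfc_const_one ℂ U]
  rw [hcfc] at hsub
  -- Monotonicity makes both norms peak at the same eigenvalue, the one farthest from `1`.
  have hmono : Monotone fun r : ℝ => 2 * Real.arcsin (r / 2) := fun a b hab => by
    have := Real.monotone_arcsin (show a / 2 ≤ b / 2 by linarith)
    simpa using this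
  have h := hmono.map_isGreatest hsub
  rw [image_image] at h
  have himg : (fun z => 2 * Real.arcsin (‖z - 1‖ / 2)) '' spectrum ℂ U =
      (fun z => ‖Complex.log z‖) '' spectrum ℂ U :=
    image_congr fun z hz => (norm_log_eq_two_mul_arcsin (norm_eq_one_of_mem_spectrum hU hz)).symm
  rw [himg] at h
  rw [norm_smul, Complex.norm_I, one_mul]
  exact hlog.unique h

lemma exp_matrixLog {U : Matrix n n ℂ} (hU : U ∈ Matrix.unitaryGroup n ℂ) :
    NormedSpace.exp (matrixLog U) = U := by
  have hN := isStarNormal_of_mem_unitaryGroup hU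
  rw [matrixLog, ← CFC.complex_exp_eq_normedSpace_exp (cfc_predicate _ _),
    ← cfc_comp' _ _ U ((Matrix.finite_spectrum U).image _ |>.continuousOn _)
      (continuousOn_spectrum _ _)]
  conv_rhs => rw [← cfc_id' ℂ U]
  refine cfc_congr fun z hz => Complex.exp_log ?_
  rintro rfl
  simpa using norm_eq_one_of_mem_spectrum hU hz

lemma isHermitian_smul_matrixLog {U : Matrix n n ℂ} (hU : U ∈ Matrix.unitaryGroup n ℂ) :
    (Complex.I • matrixLog U).IsHermitian := by
  have hN := isStarNormal_of_mem_unitaryGroup hU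
  rw [matrixLog, ← cfc_smul _ _ U (continuousOn_spectrum _ _), Matrix.IsHermitian,
    ← Matrix.star_eq_conjTranspose, ← cfc_star]
  refine cfc_congr fun z hz => ?_
  simp [Complex.log, norm_eq_one_of_mem_spectrum hU hz]

end Log

end QuantumCharging

namespace QuantumCharging

open Set Filter Topology MeasureTheory

/-! ### Time-ordered exponentials -/

section Evolution

variable {n : Type*} [Fintype n] [DecidableEq n]

/-- A function whose increments are quadratically small is constant. -/
lemma eq_of_norm_sub_le_sq {F : Type*} [NormedAddCommGroup F] [NormedSpace ℝ F] {f : ℝ → F}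
    {T C : ℝ} (hf : ∀ s ∈ Icc 0 T, ∀ t ∈ Icc 0 T, s ≤ t → ‖f t - f s‖ ≤ C * (t - s) ^ 2)
    (hcont : ContinuousOn f (Icc 0 T)) {t : ℝ} (ht : t ∈ Icc 0 T) : f t = f 0 := by
  refine constant_of_has_deriv_right_zero hcont (fun x hx => ?_) t ht
  rw [hasDerivWithinAt_iff_isLittleO]
  have hO : (fun y => f y - f x - (y - x) • (0 : F)) =O[𝓝[Ici x] x] fun y => (y - x) ^ 2 := by
    refine Asymptotics.IsBigO.of_bound C ?_
    have hmem : Icc x T ∈ 𝓝[Ici x] x := Icc_mem_nhdsGE hx.2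
    filter_upwards [hmem] with y hy
    have := hf x ⟨hx.1, hx.2.le⟩ y ⟨hx.1.trans hy.1, hy.2⟩ hy.1
    simpa using this
  refine hO.trans_isLittleO ?_
  have hlim : Tendsto (fun y : ℝ => y - x) (𝓝[Ici x] x) (𝓝 0) := by
    have : Tendsto (fun y : ℝ => y - x) (𝓝 x) (𝓝 (x - x)) := tendsto_id.sub_const x
    rw [sub_self] at this
    exact this.mono_left nhdsWithin_le_nhds
  have := (Asymptotics.isLittleO_pow_id (𝕜 := ℝ) one_lt_two).comp_tendsto hlim
  exact this

variable {T : ℝ} {V Φ : ℝ → Matrix n n ℂ}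

lemma IsChargingHamiltonian.integrableOn_mul (hV : IsChargingHamiltonian T V)
    {Ψ : ℝ → Matrix n n ℂ} (hΨ : ContinuousOn Ψ (Icc 0 T)) :
    IntegrableOn (fun s => V s * Ψ s) (Icc 0 T) := by
  obtain ⟨M, hM⟩ := isCompact_Icc.exists_bound_of_continuousOn hΨ
  refine Integrable.of_bound
    (hV.measurable.mul (hΨ.aestronglyMeasurable measurableSet_Icc)) M ?_
  filter_upwards [ae_restrict_mem measurableSet_Icc] with s hs
  calc ‖V s * Ψ s‖ ≤ ‖V s‖ * ‖Ψ s‖ := norm_mul_le _ _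
    _ ≤ M := by rw [hV.norm_eq_one s hs, one_mul]; exact hM s hs

lemma IsChargingHamiltonian.intervalIntegrable_mul (hV : IsChargingHamiltonian T V)
    {Ψ : ℝ → Matrix n n ℂ} (hΨ : ContinuousOn Ψ (Icc 0 T)) {s t : ℝ} (hs : s ∈ Icc 0 T)
    (ht : t ∈ Icc 0 T) : IntervalIntegrable (fun s => V s * Ψ s) volume s t := by
  refine ((hV.integrableOn_mul hΨ).mono_set ?_).intervalIntegrable
  exact uIcc_subset_Icc hs ht

lemma evolution_sub (hV : IsChargingHamiltonian T V) (hΦ : ContinuousOn Φ (Icc 0 T))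
    (heq : ∀ t ∈ Icc 0 T, Φ t = 1 - Complex.I • ∫ s in (0 : ℝ)..t, V s * Φ s)
    {s t : ℝ} (hs : s ∈ Icc 0 T) (ht : t ∈ Icc 0 T) :
    Φ t - Φ s = -Complex.I • ∫ r in s..t, V r * Φ r := by
  have h0 : (0 : ℝ) ∈ Icc 0 T := ⟨le_rfl, hs.1.trans hs.2⟩
  rw [heq t ht, heq s hs, ← intervalIntegral.integral_add_adjacent_intervals
    (hV.intervalIntegrable_mul hΦ h0 hs) (hV.intervalIntegrable_mul hΦ hs ht), smul_add, neg_smul]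
  abel

lemma norm_evolution_sub_le (hV : IsChargingHamiltonian T V) (hΦ : ContinuousOn Φ (Icc 0 T))
    (heq : ∀ t ∈ Icc 0 T, Φ t = 1 - Complex.I • ∫ s in (0 : ℝ)..t, V s * Φ s)
    {M : ℝ} (hM : ∀ t ∈ Icc 0 T, ‖Φ t‖ ≤ M)
    {s t : ℝ} (hs : s ∈ Icc 0 T) (ht : t ∈ Icc 0 T) (hst : s ≤ t) :
    ‖Φ t - Φ s‖ ≤ M * (t - s) := by
  rw [evolution_sub hV hΦ heq hs ht, norm_smul, norm_neg, Complex.norm_I, one_mul]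
  refine (intervalIntegral.norm_integral_le_of_norm_le_const (C := M) fun r hr => ?_).trans ?_
  · rw [uIoc_of_le hst] at hr
    have hr' : r ∈ Icc 0 T := ⟨hs.1.trans hr.1.le, hr.2.trans ht.2⟩
    calc ‖V r * Φ r‖ ≤ ‖V r‖ * ‖Φ r‖ := norm_mul_le _ _
      _ ≤ M := by rw [hV.norm_eq_one r hr', one_mul]; exact hM r hr'
  · rw [abs_of_nonneg (by linarith)]

lemma IsChargingHamiltonian.isHermitian_integral (hV : IsChargingHamiltonian T V)
    {s t : ℝ} (hs : s ∈ Icc 0 T) (ht : t ∈ Icc 0 T) :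
    (∫ r in s..t, V r).IsHermitian := by
  have hint : IntervalIntegrable V volume s t := by
    simpa using hV.intervalIntegrable_mul (Ψ := fun _ => 1) continuousOn_const hs ht
  have h := ContinuousLinearMap.intervalIntegral_comp_comm
    ((starL' ℝ : Matrix n n ℂ ≃L[ℝ] Matrix n n ℂ) : Matrix n n ℂ →L[ℝ] Matrix n n ℂ) hint
  rw [Matrix.IsHermitian, ← Matrix.star_eq_conjTranspose]
  refine Eq.trans h.symm (intervalIntegral.integral_congr fun r hr => ?_)
  exact hV.hermitian r (uIcc_subset_Icc hs ht hr)

/-- The first-order expansion of the evolution, with quadratic error. -/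
lemma norm_evolution_sub_linear_le (hV : IsChargingHamiltonian T V)
    (hΦ : ContinuousOn Φ (Icc 0 T))
    (heq : ∀ t ∈ Icc 0 T, Φ t = 1 - Complex.I • ∫ s in (0 : ℝ)..t, V s * Φ s)
    {M : ℝ} (hM : ∀ t ∈ Icc 0 T, ‖Φ t‖ ≤ M)
    {s t : ℝ} (hs : s ∈ Icc 0 T) (ht : t ∈ Icc 0 T) (hst : s ≤ t) :
    ‖Φ t - Φ s - (-Complex.I • ((∫ r in s..t, V r) * Φ s))‖ ≤ M * (t - s) ^ 2 := by
  have hM0 : 0 ≤ M := (norm_nonneg _).trans (hM s hs)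
  have hint : IntervalIntegrable V volume s t := by
    simpa using hV.intervalIntegrable_mul (Ψ := fun _ => 1) continuousOn_const hs ht
  have hmul : (∫ r in s..t, V r) * Φ s = ∫ r in s..t, V r * Φ s :=
    (ContinuousLinearMap.intervalIntegral_comp_comm
      ((ContinuousLinearMap.mul ℝ (Matrix n n ℂ)).flip (Φ s)) hint).symm
  rw [evolution_sub hV hΦ heq hs ht, hmul, ← smul_sub, ← intervalIntegral.integral_sub
    (hV.intervalIntegrable_mul hΦ hs ht)
    (hV.intervalIntegrable_mul (Ψ := fun _ => Φ s) continuousOn_const hs ht),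
    norm_smul, norm_neg, Complex.norm_I, one_mul]
  refine (intervalIntegral.norm_integral_le_of_norm_le_const (C := M * (t - s))
    fun r hr => ?_).trans ?_
  · rw [uIoc_of_le hst] at hr
    have hr' : r ∈ Icc 0 T := ⟨hs.1.trans hr.1.le, hr.2.trans ht.2⟩
    rw [← mul_sub]
    calc ‖V r * (Φ r - Φ s)‖ ≤ ‖V r‖ * ‖Φ r - Φ s‖ := norm_mul_le _ _
      _ = ‖Φ r - Φ s‖ := by rw [hV.norm_eq_one r hr', one_mul]
      _ ≤ M * (r - s) := norm_evolution_sub_le hV hΦ heq hM hs hr' hr.1.le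
      _ ≤ M * (t - s) := by
        have := hr.2
        gcongr
  · rw [abs_of_nonneg (by linarith)]
    exact le_of_eq (by ring)

/-- As `V` is only measurable, `Φ` need not be differentiable everywhere. Instead the increments of
`Φᴴ Φ` are shown to be quadratically small. -/
lemma evolution_conjTranspose_mul_self (hV : IsChargingHamiltonian T V)
    (hΦ : ContinuousOn Φ (Icc 0 T))
    (heq : ∀ t ∈ Icc 0 T, Φ t = 1 - Complex.I • ∫ s in (0 : ℝ)..t, V s * Φ s)
    {t : ℝ} (ht : t ∈ Icc 0 T) : (Φ t)ᴴ * Φ t = 1 := by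
  obtain ⟨M, hM⟩ := isCompact_Icc.exists_bound_of_continuousOn hΦ
  have h0 : (0 : ℝ) ∈ Icc 0 T := ⟨le_rfl, ht.1.trans ht.2⟩
  have hM0 : 0 ≤ M := (norm_nonneg _).trans (hM 0 h0)
  have hΦ0 : Φ 0 = 1 := by simp [heq 0 h0]
  have hquad : ∀ s ∈ Icc 0 T, ∀ t ∈ Icc 0 T, s ≤ t →
      ‖star (Φ t) * Φ t - star (Φ s) * Φ s‖ ≤ (3 * M ^ 2) * (t - s) ^ 2 := by
    intro s hs t ht hst
    set A := ∫ r in s..t, V r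
    set Δ := Φ t - Φ s with hΔ
    set R := Δ - (-Complex.I • (A * Φ s)) with hR
    have hA : star A = A := hV.isHermitian_integral hs ht
    have hRn : ‖R‖ ≤ M * (t - s) ^ 2 := norm_evolution_sub_linear_le hV hΦ heq hM hs ht hst
    have hΔn : ‖Δ‖ ≤ M * (t - s) := norm_evolution_sub_le hV hΦ heq hM hs ht hst
    have hΔR : Δ = -Complex.I • (A * Φ s) + R := by rw [hR]; abel
    have hdecomp : star (Φ t) * Φ t - star (Φ s) * Φ s =
        star R * Φ s + star (Φ s) * R + star Δ * Δ := by
      have h1 : star (Φ t) * Φ t - star (Φ s) * Φ s =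
          star Δ * Φ s + star (Φ s) * Δ + star Δ * Δ := by
        rw [show Φ t = Φ s + Δ by rw [hΔ]; abel, star_add]
        noncomm_ring
      -- The first-order terms cancel because `A` is self-adjoint; only the remainder `R` survives.
      have h2 : star Δ * Φ s + star (Φ s) * Δ = star R * Φ s + star (Φ s) * R := by
        rw [hΔR]
        simp only [star_add, star_smul, star_mul, hA, add_mul, mul_add, smul_mul_assoc,
          mul_smul_comm, mul_assoc]
        simp
        abel
      rw [h1, h2]
    rw [hdecomp]
    have hs' := hM s hs
    calc ‖star R * Φ s + star (Φ s) * R + star Δ * Δ‖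
        ≤ ‖star R * Φ s‖ + ‖star (Φ s) * R‖ + ‖star Δ * Δ‖ := norm_add₃_le
      _ ≤ ‖R‖ * ‖Φ s‖ + ‖Φ s‖ * ‖R‖ + ‖Δ‖ * ‖Δ‖ := by
        refine add_le_add (add_le_add ?_ ?_) ?_ <;>
        exact (norm_mul_le _ _).trans (by rw [norm_star])
      _ ≤ (M * (t - s) ^ 2) * M + M * (M * (t - s) ^ 2) + (M * (t - s)) * (M * (t - s)) := by
        gcongr
      _ = (3 * M ^ 2) * (t - s) ^ 2 := by ring
  have h := eq_of_norm_sub_le_sq hquad (hΦ.star.mul hΦ) ht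
  rw [← Matrix.star_eq_conjTranspose, h, hΦ0, star_one, one_mul]

/-- A unitary generated in time `T` has principal logarithm of norm at most `T`. -/
lemma norm_smul_matrixLog_le_of_isTimeOrderedExp [Nonempty n] (hT : 0 ≤ T)
    (hV : IsChargingHamiltonian T V) {U : Matrix n n ℂ} (hU : IsTimeOrderedExp V T U) :
    U ∈ Matrix.unitaryGroup n ℂ ∧ ‖Complex.I • matrixLog U‖ ≤ T := by
  obtain ⟨Φ, hΦ, heq, rfl⟩ := hU
  have hunit : ∀ t ∈ Icc 0 T, Φ t ∈ Matrix.unitaryGroup n ℂ := fun t ht =>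
    Matrix.mem_unitaryGroup_iff'.2 (evolution_conjTranspose_mul_self hV hΦ heq ht)
  have h0 : (0 : ℝ) ∈ Icc 0 T := ⟨le_rfl, hT⟩
  have hTm : T ∈ Icc 0 T := ⟨hT, le_rfl⟩
  have hΦ0 : Φ 0 = 1 := by simp [heq 0 h0]
  refine ⟨hunit T hTm, ?_⟩
  rw [norm_smul_matrixLog (hunit T hTm)]
  -- Beyond `π` the chord bound is lost, but the principal logarithm never exceeds `π` in norm.
  rcases le_total Real.pi T with hpi | hpi
  · linarith [Real.arcsin_le_pi_div_two (‖Φ T - 1‖ / 2)]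
  have hnorm : ∀ t ∈ Icc 0 T, ‖Φ t‖ ≤ 1 := fun t ht =>
    (CStarRing.norm_of_mem_unitary (hunit t ht)).le
  have hchord : ‖Φ T - 1‖ ≤ 2 * Real.sin (T / 2) := by
    have hsin : 0 ≤ 2 * Real.sin (T / 2) :=
      mul_nonneg zero_le_two (Real.sin_nonneg_of_nonneg_of_le_pi (by linarith) (by linarith))
    -- The angle is taken for the real part of the inner product, so a global phase counts as
    -- motion.
    let _ : InnerProductSpace ℝ (EuclideanSpace ℂ n) := InnerProductSpace.complexToReal
    rw [← Matrix.l2_opNorm_toEuclideanCLM]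
    refine ContinuousLinearMap.opNorm_le_of_unit_norm hsin fun x hx => ?_
    set γ : ℝ → EuclideanSpace ℂ n := fun t => Matrix.toEuclideanCLM (n := n) (𝕜 := ℂ) (Φ t) x
    have hγ0 : γ 0 = x := by simp [γ, hΦ0]
    have hγn : ∀ t ∈ Icc 0 T, ‖γ t‖ = 1 := by
      intro t ht
      have hu : Matrix.toEuclideanCLM (n := n) (𝕜 := ℂ) (Φ t) ∈
          unitary (EuclideanSpace ℂ n →L[ℂ] EuclideanSpace ℂ n) := Unitary.map_mem _ (hunit t ht)
      rw [← hx]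
      exact ContinuousLinearMap.norm_map_of_mem_unitary hu x
    have hlip : ∀ s ∈ Icc 0 T, ∀ t ∈ Icc 0 T, s ≤ t → ‖γ s - γ t‖ ≤ t - s := by
      intro s hs t ht hst
      have h1 : γ t - γ s = Matrix.toEuclideanCLM (n := n) (𝕜 := ℂ) (Φ t - Φ s) x := by
        simp [γ]
      rw [norm_sub_rev, h1]
      refine (ContinuousLinearMap.le_opNorm _ _).trans ?_
      rw [hx, mul_one, Matrix.l2_opNorm_toEuclideanCLM]
      simpa using norm_evolution_sub_le hV hΦ heq hnorm hs ht hst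
    have hang := angle_le_of_lipschitz_on_sphere hT hγn hlip
    have hsub : Matrix.toEuclideanCLM (n := n) (𝕜 := ℂ) (Φ T - 1) x = γ T - γ 0 := by
      rw [hγ0]; simp [γ]
    rw [hsub, norm_sub_rev, norm_sub_eq_two_mul_sin_half_angle (hγn 0 h0) (hγn T hTm)]
    have hθ := InnerProductGeometry.angle_nonneg (γ 0) (γ T)
    have := Real.sin_le_sin_of_le_of_le_pi_div_two (x := InnerProductGeometry.angle (γ 0) (γ T) / 2)
      (y := T / 2) (by linarith [Real.pi_pos]) (by linarith) (by linarith)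
    linarith
  have := Real.monotone_arcsin (show ‖Φ T - 1‖ / 2 ≤ Real.sin (T / 2) by linarith)
  rw [Real.arcsin_sin (by linarith [Real.pi_pos]) (by linarith)] at this
  linarith

lemma isTimeOrderedExp_const (V : Matrix n n ℂ) {T : ℝ} :
    IsTimeOrderedExp (fun _ => V) T (NormedSpace.exp ((T : ℂ) • (-Complex.I • V))) := by
  set A := -Complex.I • V with hA
  have hderiv : ∀ t : ℝ, HasDerivAt (fun t : ℝ => NormedSpace.exp ((t : ℂ) • A))
      (A * NormedSpace.exp ((t : ℂ) • A)) t := fun t => by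
    have h := (hasDerivAt_exp_smul_const' (𝕂 := ℂ) A (t : ℂ)).scomp t
      Complex.ofRealCLM.hasDerivAt
    rw [Complex.ofRealCLM_apply, Complex.ofReal_one, one_smul] at h
    exact h
  have hcont : Continuous fun t : ℝ => NormedSpace.exp ((t : ℂ) • A) :=
    continuous_iff_continuousAt.2 fun t => (hderiv t).continuousAt
  refine ⟨fun t => NormedSpace.exp ((t : ℂ) • A), hcont.continuousOn, fun t _ => ?_, rfl⟩
  have hftc := intervalIntegral.integral_eq_sub_of_hasDerivAt (a := 0) (b := t)
    (fun s _ => hderiv s) ((continuous_const.mul hcont).intervalIntegrable _ _)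
  have hI : Complex.I • ∫ s in (0 : ℝ)..t, V * NormedSpace.exp ((s : ℂ) • A) =
      -∫ s in (0 : ℝ)..t, A * NormedSpace.exp ((s : ℂ) • A) := by
    rw [← intervalIntegral.integral_smul, ← intervalIntegral.integral_neg]
    simp [hA]
  rw [hI, hftc]
  simp

end Evolution

end QuantumCharging

namespace QuantumCharging

open Set Filter Topology MeasureTheory

/-! ### Existence of optimal unitaries and the Hamiltonians generating them -/

section Optimal

lemma IsDensityMatrix.nonempty {n : Type*} [Fintype n] {ρ : Matrix n n ℂ}
    (hρ : IsDensityMatrix ρ) : Nonempty n := by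
  by_contra h
  have := not_nonempty_iff.1 h
  simpa using hρ.2

variable {n : Type*} [Fintype n] [DecidableEq n] {ρ σ : Matrix n n ℂ}

/-- Both matrices diagonalise to the same diagonal matrix, so one eigenbasis can be carried to the
other. -/
lemma connectingUnitaries_nonempty (hρ : ρ.IsHermitian) (hσ : σ.IsHermitian)
    (hspec : SameSpectrum ρ σ) : (connectingUnitaries ρ σ).Nonempty := by
  have hchar : ρ.charpoly = σ.charpoly := by
    rw [hρ.splits_charpoly.eq_prod_roots_of_monic ρ.charpoly_monic,
      hσ.splits_charpoly.eq_prod_roots_of_monic σ.charpoly_monic, hspec]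
  have heig := (Matrix.IsHermitian.eigenvalues_eq_eigenvalues_iff hρ hσ).2 hchar
  have hρ' := hρ.spectral_theorem
  have hσ' := hσ.spectral_theorem
  rw [← heig] at hσ'
  refine ⟨(hσ.eigenvectorUnitary * star hρ.eigenvectorUnitary :
    Matrix.unitaryGroup n ℂ), Subtype.property _, ?_⟩
  rw [← Matrix.star_eq_conjTranspose]
  change (Unitary.conjStarAlgAut ℂ _ (hσ.eigenvectorUnitary * star hρ.eigenvectorUnitary)) ρ = σ
  rw [Unitary.conjStarAlgAut_mul_apply, hρ.conjStarAlgAut_star_eigenvectorUnitary, ← hσ']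

lemma isCompact_connectingUnitaries [Nonempty n] (ρ σ : Matrix n n ℂ) :
    IsCompact (connectingUnitaries ρ σ) := by
  have : ProperSpace (Matrix n n ℂ) := FiniteDimensional.proper ℂ _
  refine (isCompact_closedBall (0 : Matrix n n ℂ) 1).of_isClosed_subset ?_ ?_
  · have h : connectingUnitaries ρ σ =
        {U | U * star U = 1} ∩ {U | U * ρ * star U = σ} := by
      ext U
      simp [connectingUnitaries, Matrix.mem_unitaryGroup_iff, Matrix.star_eq_conjTranspose]
    rw [h]
    exact (isClosed_eq (by fun_prop) continuous_const).inter
      (isClosed_eq (by fun_prop) continuous_const)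
  · intro U hU
    simpa using (CStarRing.norm_of_mem_unitary hU.1).le

/-- The logarithm itself jumps at eigenvalue `-1`, but its norm is continuous by
`norm_smul_matrixLog`. -/
lemma exists_isOptimalUnitary [Nonempty n] (h : (connectingUnitaries ρ σ).Nonempty) :
    ∃ U, IsOptimalUnitary ρ σ U := by
  have hcont : ContinuousOn (fun U : Matrix n n ℂ => ‖Complex.I • matrixLog U‖)
      (connectingUnitaries ρ σ) := by
    have hc : Continuous fun U : Matrix n n ℂ => 2 * Real.arcsin (‖U - 1‖ / 2) := by fun_prop
    exact hc.continuousOn.congr fun U hU => norm_smul_matrixLog hU.1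
  obtain ⟨U, hU, hmin⟩ := (isCompact_connectingUnitaries ρ σ).exists_isMinOn h hcont
  exact ⟨U, hU, fun W hW => hmin hW⟩

lemma isTimeOrderedExp_smul_matrixLog {U : Matrix n n ℂ} (hU : U ∈ Matrix.unitaryGroup n ℂ)
    {D : ℝ} (hD : D ≠ 0) :
    IsTimeOrderedExp (fun _ => (D : ℂ)⁻¹ • (Complex.I • matrixLog U)) D U := by
  have h := isTimeOrderedExp_const ((D : ℂ)⁻¹ • (Complex.I • matrixLog U)) (T := D)
  have hD' : (D : ℂ) ≠ 0 := by exact_mod_cast hD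
  have hc : (D : ℂ) * -Complex.I * (D : ℂ)⁻¹ * Complex.I = 1 := by
    field_simp
    simp
  have hs : (D : ℂ) • (-Complex.I • ((D : ℂ)⁻¹ • (Complex.I • matrixLog U))) = matrixLog U := by
    rw [smul_smul, smul_smul, smul_smul, hc, one_smul]
  rwa [hs, exp_matrixLog hU] at h

lemma isChargingHamiltonian_smul_matrixLog {U : Matrix n n ℂ}
    (hU : U ∈ Matrix.unitaryGroup n ℂ) (hD : 0 < ‖Complex.I • matrixLog U‖) (T : ℝ) :
    IsChargingHamiltonian T
      (fun _ => ((‖Complex.I • matrixLog U‖ : ℝ) : ℂ)⁻¹ • (Complex.I • matrixLog U)) where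
  measurable := aestronglyMeasurable_const
  hermitian _ _ := by
    rw [← Complex.ofReal_inv, Complex.coe_smul]
    exact (isHermitian_smul_matrixLog hU).smul (IsSelfAdjoint.all _)
  norm_eq_one _ _ := by
    rw [norm_smul, norm_inv, Complex.norm_real, norm_norm, inv_mul_cancel₀ hD.ne']

lemma isTimeOrderedExp_zero (V : ℝ → Matrix n n ℂ) : IsTimeOrderedExp V 0 1 :=
  ⟨fun _ => 1, continuousOn_const, fun t ht => by simp [le_antisymm ht.2 ht.1], rfl⟩

lemma isChargingHamiltonian_one [Nonempty n] (T : ℝ) :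
    IsChargingHamiltonian T (fun _ => (1 : Matrix n n ℂ)) where
  measurable := aestronglyMeasurable_const
  hermitian _ _ := Matrix.isHermitian_one
  norm_eq_one _ _ := CStarRing.norm_one

lemma eq_one_of_norm_smul_matrixLog_eq_zero {U : Matrix n n ℂ}
    (hU : U ∈ Matrix.unitaryGroup n ℂ) (h : ‖Complex.I • matrixLog U‖ = 0) : U = 1 := by
  have h0 : matrixLog U = 0 := by simpa using h
  rw [← exp_matrixLog hU, h0, NormedSpace.exp_zero]

lemma exists_charges_of_mem_connectingUnitaries [Nonempty n] {U : Matrix n n ℂ}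
    (hU : U ∈ connectingUnitaries ρ σ) :
    ∃ V : Matrix n n ℂ, Charges ρ σ (fun _ => V) ‖Complex.I • matrixLog U‖ ∧
      IsTimeOrderedExp (fun _ => V) ‖Complex.I • matrixLog U‖ U := by
  rcases (norm_nonneg (Complex.I • matrixLog U)).eq_or_lt with h | h
  · have h1 := eq_one_of_norm_smul_matrixLog_eq_zero hU.1 h.symm
    have hT : IsTimeOrderedExp (fun _ => (1 : Matrix n n ℂ)) ‖Complex.I • matrixLog U‖ U := by
      rw [← h, h1]
      exact isTimeOrderedExp_zero _
    exact ⟨1, ⟨norm_nonneg _, isChargingHamiltonian_one _, U, hT, hU.2⟩, hT⟩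
  · have hT := isTimeOrderedExp_smul_matrixLog hU.1 h.ne'
    exact ⟨_, ⟨norm_nonneg _, isChargingHamiltonian_smul_matrixLog hU.1 h _, U, hT, hU.2⟩, hT⟩

/-- The minimal norm of `i ln U` is the minimal charging time. -/
lemma IsOptimalUnitary.isLeast_chargingTimes [Nonempty n] {U : Matrix n n ℂ}
    (hU : IsOptimalUnitary ρ σ U) :
    IsLeast (chargingTimes ρ σ) ‖Complex.I • matrixLog U‖ := by
  constructor
  · obtain ⟨V, hV, -⟩ := exists_charges_of_mem_connectingUnitaries hU.1
    exact ⟨_, hV⟩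
  · rintro T ⟨V, hT, hV, W, hW, hWρ⟩
    obtain ⟨hWu, hle⟩ := norm_smul_matrixLog_le_of_isTimeOrderedExp hT hV hW
    exact (hU.2 W ⟨hWu, hWρ⟩).trans hle

lemma IsOptimalUnitary.chargingDistance_eq [Nonempty n] {U : Matrix n n ℂ}
    (hU : IsOptimalUnitary ρ σ U) : chargingDistance ρ σ = ‖Complex.I • matrixLog U‖ :=
  hU.isLeast_chargingTimes.csInf_eq

end Optimal

end QuantumCharging

/-! ### The main theorem -/

theorem theorem2 {n : Type*} [Fintype n] [DecidableEq n] (ρ σ : Matrix n n ℂ)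
    (hρ : QuantumCharging.IsDensityMatrix ρ) (hσ : QuantumCharging.IsDensityMatrix σ)
    (hspec : QuantumCharging.SameSpectrum ρ σ) :
    -- the minimal charging time exists
    IsLeast (QuantumCharging.chargingTimes ρ σ) (QuantumCharging.chargingDistance ρ σ) ∧
    -- it is attained by a time-independent Hamiltonian
    (∃ V : Matrix n n ℂ,
      QuantumCharging.Charges ρ σ (fun _ => V) (QuantumCharging.chargingDistance ρ σ)) ∧
    -- it equals the (attained) minimum of the norm of `i ln U`
    IsLeast ((fun U => ‖Complex.I • QuantumCharging.matrixLog U‖) ''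
        QuantumCharging.connectingUnitaries ρ σ)
      (QuantumCharging.chargingDistance ρ σ) ∧
    -- every optimal unitary is reached in the minimal time, by `i ln U / D` if the states differ
    ∀ U : Matrix n n ℂ, QuantumCharging.IsOptimalUnitary ρ σ U →
      (∃ V : Matrix n n ℂ,
        QuantumCharging.Charges ρ σ (fun _ => V) (QuantumCharging.chargingDistance ρ σ) ∧
        QuantumCharging.IsTimeOrderedExp (fun _ => V)
          (QuantumCharging.chargingDistance ρ σ) U) ∧
      (ρ ≠ σ →
        0 < QuantumCharging.chargingDistance ρ σ ∧
        QuantumCharging.Charges ρ σ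
          (fun _ => ((QuantumCharging.chargingDistance ρ σ : ℝ) : ℂ)⁻¹ •
            (Complex.I • QuantumCharging.matrixLog U))
          (QuantumCharging.chargingDistance ρ σ) ∧
        QuantumCharging.IsTimeOrderedExp
          (fun _ => ((QuantumCharging.chargingDistance ρ σ : ℝ) : ℂ)⁻¹ •
            (Complex.I • QuantumCharging.matrixLog U))
          (QuantumCharging.chargingDistance ρ σ) U) := by
  have := hρ.nonempty
  obtain ⟨U₀, hU₀⟩ := QuantumCharging.exists_isOptimalUnitary
    (QuantumCharging.connectingUnitaries_nonempty hρ.1.isHermitian hσ.1.isHermitian hspec)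
  refine ⟨?_, ?_, ?_, fun U hU => ?_⟩
  · rw [hU₀.chargingDistance_eq]
    exact hU₀.isLeast_chargingTimes
  · rw [hU₀.chargingDistance_eq]
    obtain ⟨V, hV, -⟩ := QuantumCharging.exists_charges_of_mem_connectingUnitaries hU₀.1
    exact ⟨V, hV⟩
  · rw [hU₀.chargingDistance_eq]
    refine ⟨⟨U₀, hU₀.1, rfl⟩, ?_⟩
    rintro _ ⟨W, hW, rfl⟩
    exact hU₀.2 W hW
  · rw [hU.chargingDistance_eq]
    refine ⟨QuantumCharging.exists_charges_of_mem_connectingUnitaries hU.1, fun hne => ?_⟩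
    -- Distance zero would force `U = 1`, hence `ρ = σ`.
    have hpos : 0 < ‖Complex.I • QuantumCharging.matrixLog U‖ := by
      refine (norm_nonneg _).lt_of_ne' fun h => hne ?_
      have h1 := QuantumCharging.eq_one_of_norm_smul_matrixLog_eq_zero hU.1.1 h
      simpa [h1] using hU.1.2
    have hT := QuantumCharging.isTimeOrderedExp_smul_matrixLog hU.1.1 hpos.ne'
    exact ⟨hpos, ⟨norm_nonneg _,
      QuantumCharging.isChargingHamiltonian_smul_matrixLog hU.1.1 hpos _, U, hT, hU.1.2⟩, hT⟩
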